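/- Let $P^n$ be an $n$-dimensional simple convex polytope with $k+n$ facets $F_1,\dots,F_{k+n}$, let $v_0$ be a vertex of $P^n$, and let the facets be numbered so that $F_1,\dots,F_k$ are the ones that do not contain $v_0$. Let $\mu:\{F_1,\dots,F_{k+n}\}\to(\mathbb{Z}_2)^n$ be a characteristic function: whenever $F_{i_1}\cap\dots\cap F_{i_s}\neq\varnothing$ (with distinct indices), the vectors $\mu(F_{i_1}),\dots,\mu(F_{i_s})$ are linearly independent. Let $Q^n=P^n\times(\mathbb{Z}_2)^n/\!\sim$ be the small cover, where $(p,w)\sim(p',w')$ iff $p=p'$ and $w-w'\in\langle\mu(F_i): p\in F_i\rangle$. Let $V^n$ be the core obtained by cutting $Q^n$ open along the first $k$ facets, i.e. $V^n=P^n\times(\mathbb{Z}_2)^n/\!\sim_V$, where $(p,w)\sim_V(p',w')$ iff $p=p'$ and $w-w'\in\langle\mu(F_i): i>k,\ p\in F_i\rangle$. Its panels are $P_i=\{[p,w]: p\in F_i\}$, $1\le i\le k$, with the free commuting involutions $\tau_i:P_i\to P_i$, $\tau_i[p,w]=[p,w+\mu(F_i)]$. Let $\lambda_0$ be a maximally independent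 $(\mathbb{Z}_2)^k$-coloring of the panels, i.e. $\lambda_0(P_1),\dots,\lambda_0(P_k)$ span $(\mathbb{Z}_2)^k$. Let $M(V^n,\lambda_0)$ be the quotient of $V^n\times(\mathbb{Z}_2)^k$ by the equivalence relation generated by $(x,g)\sim(\tau_i(x),g+\lambda_0(P_i))$ for $x\in P_i$, with the natural action $g\cdot[(x,g_0)]=[(x,g+g_0)]$ and the projection $[([p,w],g)]\mapsto[p,w]$ to $Q^n$. Let $e_1,\dots,e_{k+n}$ be the standard basis of $(\mathbb{Z}_2)^{k+n}$, and let $\mathcal{Z}_{P^n}=P^n\times(\mathbb{Z}_2)^{k+n}/\!\sim$ be the real moment-angle manifold, where $(p,g)\sim(p',g')$ iff $p=p'$ and $g-g'\in\langle e_i:p\in F_i\rangle$, with the canonical action $g_0\cdot[p,g]=[p,g_0+g]$ and the projection $[p,g]\mapsto[p,\sum_i g_i\mu(F_i)]$ to $Q^n$. Embed $(\mathbb{Z}_2)^n$ in $(\mathbb{Z}_2)^{k+n}$ by identifying the basis $\mu(F_{k+1}),\dots,\mu(F_{k+n})$ of $(\mathbb{Z}_2)^n$ with $e_{k+1},\dots,e_{k+n}$,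 and let $H_\mu\subset(\mathbb{Z}_2)^{k+n}$ be the subgroup generated by $e_i+\mu(F_i)$, $1\le i\le k$. Then there is a group isomorphism $\sigma:(\mathbb{Z}_2)^k\to H_\mu$ with $\sigma(\lambda_0(P_i))=e_i+\mu(F_i)$ for $1\le i\le k$ (so $H_\mu$ has rank $k$) such that: (1) The natural $(\mathbb{Z}_2)^k$-action on $M(V^n,\lambda_0)$ and the restriction to $H_\mu$ of the canonical $(\mathbb{Z}_2)^{k+n}$-action on $\mathcal{Z}_{P^n}$ are free, the projections to $Q^n$ make both spaces principal bundles over $Q^n$ (regular coverings with deck groups $(\mathbb{Z}_2)^k$ and $H_\mu$), and the two actions are equivalent: there is a homeomorphism $f:M(V^n,\lambda_0)\to\mathcal{Z}_{P^n}$ with $f(g\cdot x)=\sigma(g)\cdot f(x)$ for all $g\in(\mathbb{Z}_2)^k$ and all $x$, which induces the identity on $Q^n$. (2) For every subgroup $N\subset(\mathbb{Z}_2)^k$, the same holds for the induced $(\mathbb{Z}_2)^k/N$-action on $M(V^n,\lambda_0)/N$ and the induced $H_\mu/\sigma(N)$-action on $\mathcal{Z}_{P^n}/\sigma(N)$, with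 the induced projections to $Q^n$ and the isomorphism $(\mathbb{Z}_2)^k/N\to H_\mu/\sigma(N)$ induced by $\sigma$. -/

import Mathlib

noncomputable section

namespace GlueBack

/-- `F` is a facet of the `n`-dimensional convex polytope `A`: a nonempty exposed face of
dimension `n - 1`. -/
def IsFacet {E : Type*} [NormedAddCommGroup E] [NormedSpace ℝ E] (n : ℕ) (A F : Set E) : Prop :=
  F.Nonempty ∧ IsExposed ℝ A F ∧ Module.finrank ℝ (vectorSpan ℝ F) + 1 = n

/-- An `n`-dimensional simple convex polytope with `k + n` facets, a chosen vertex `v₀`, and an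
enumeration of its facets in which the first `k` are those not incident to `v₀`. -/
structure SimplePolytope (n k : ℕ) (E : Type*) [NormedAddCommGroup E] [NormedSpace ℝ E] where
  carrier : Set E
  nonempty : carrier.Nonempty
  isPolytope : ∃ s : Set E, s.Finite ∧ carrier = convexHull ℝ s
  dim_eq : Module.finrank ℝ (vectorSpan ℝ carrier) = n
  facet : Fin (k + n) → Set E
  facet_injective : Function.Injective facet
  range_facet : Set.range facet = {F | IsFacet n carrier F}
  simple : ∀ v ∈ Set.extremePoints ℝ carrier, {i | v ∈ facet i}.ncard = n
  v₀ : E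
  v₀_mem : v₀ ∈ Set.extremePoints ℝ carrier
  v₀_mem_facet_iff : ∀ i, v₀ ∈ facet i ↔ k ≤ (i : ℕ)

/-- A characteristic function on the facets, with values in `(ℤ₂)ⁿ`: facets with a common point
have linearly independent values. -/
structure CharFun {n k : ℕ} {E : Type*} [NormedAddCommGroup E] [NormedSpace ℝ E]
    (P : SimplePolytope n k E) where
  toFun : Fin (k + n) → (Fin n → ZMod 2)
  linearIndepOn : ∀ s : Finset (Fin (k + n)), (⋂ i ∈ s, P.facet i).Nonempty →
    LinearIndepOn (ZMod 2) toFun (s : Set (Fin (k + n)))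

/-! ### Gluing copies of the polytope along facets -/

section Glued

variable {n k m : ℕ} {E : Type*} [NormedAddCommGroup E] [NormedSpace ℝ E]

/-- The subgroup generated by the colors of those facets in `I` that contain `p`. -/
def colorGroup (P : SimplePolytope n k E) (c : Fin (k + n) → (Fin m → ZMod 2))
    (I : Set (Fin (k + n))) (p : E) : AddSubgroup (Fin m → ZMod 2) :=
  AddSubgroup.closure (c '' {i | i ∈ I ∧ p ∈ P.facet i})

/-- `(p, w) ∼ (p', w')` iff `p = p'` and `w - w'` lies in the group generated by the colors of the
facets in `I` through `p`. -/
def gluedSetoid (P : SimplePolytope n k E) (c : Fin (k + n) → (Fin m → ZMod 2))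
    (I : Set (Fin (k + n))) : Setoid (P.carrier × (Fin m → ZMod 2)) where
  r a b := a.1 = b.1 ∧ a.2 - b.2 ∈ colorGroup P c I a.1
  iseqv :=
    { refl := fun a => ⟨rfl, by simp⟩
      symm := fun {a b} h => ⟨h.1.symm, by
        rw [← h.1, ← neg_sub]; exact AddSubgroup.neg_mem _ h.2⟩
      trans := fun {a b d} h h' => ⟨h.1.trans h'.1, by
        have h2 := h'.2
        rw [← h.1] at h2
        simpa using AddSubgroup.add_mem _ h.2 h2⟩ }

/-- The gluing of `2 ^ m` copies of the polytope along the facets in `I`, where crossing the facet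
`F i` changes the copy by the color `c i`. -/
def Glued (P : SimplePolytope n k E) (c : Fin (k + n) → (Fin m → ZMod 2))
    (I : Set (Fin (k + n))) : Type _ :=
  Quotient (gluedSetoid P c I)

variable {P : SimplePolytope n k E} {c : Fin (k + n) → (Fin m → ZMod 2)}
  {I : Set (Fin (k + n))}

instance : TopologicalSpace (Glued P c I) :=
  inferInstanceAs (TopologicalSpace (Quotient (gluedSetoid P c I)))

/-- The class `[p, w]`. -/
def Glued.mk (p : P.carrier) (w : Fin m → ZMod 2) : Glued P c I :=
  Quotient.mk (gluedSetoid P c I) (p, w)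

/-- The projection `[p, w] ↦ p` to the polytope. -/
def Glued.base (x : Glued P c I) : P.carrier :=
  Quotient.lift (s := gluedSetoid P c I) (fun a => a.1) (fun _ _ h => h.1) x

/-- The canonical action `g • [p, w] = [p, g + w]`. -/
instance : AddAction (Fin m → ZMod 2) (Glued P c I) where
  vadd g := Quotient.map (sa := gluedSetoid P c I) (sb := gluedSetoid P c I)
    (fun a => (a.1, g + a.2)) (fun a b h => ⟨h.1, by simpa using h.2⟩)
  zero_vadd x := by
    induction x using Quotient.inductionOn with
    | h a => exact congrArg (Quotient.mk _) (Prod.ext rfl (zero_add a.2))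
  add_vadd g h x := by
    induction x using Quotient.inductionOn with
    | h a => exact congrArg (Quotient.mk _) (Prod.ext rfl (add_assoc g h a.2))

@[simp] theorem Glued.vadd_mk (g : Fin m → ZMod 2) (p : P.carrier) (w : Fin m → ZMod 2) :
    g +ᵥ (Glued.mk p w : Glued P c I) = Glued.mk p (g + w) := rfl

theorem Glued.ind {C : Glued P c I → Prop} (h : ∀ p w, C (Glued.mk p w)) (x : Glued P c I) :
    C x :=
  Quotient.inductionOn x fun a => h a.1 a.2

theorem Glued.mk_eq_mk {p p' : P.carrier} {w w' : Fin m → ZMod 2} :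
    (Glued.mk p w : Glued P c I) = Glued.mk p' w' ↔
      p = p' ∧ w - w' ∈ colorGroup P c I p :=
  ⟨fun h => Quotient.exact h, fun h => Quotient.sound h⟩

@[simp] theorem Glued.base_vadd (g : Fin m → ZMod 2) (x : Glued P c I) :
    (g +ᵥ x).base = x.base := by
  induction x using Glued.ind with
  | h p w => rfl

theorem Glued.continuous_mk :
    Continuous (fun a : P.carrier × (Fin m → ZMod 2) => (Glued.mk a.1 a.2 : Glued P c I)) :=
  continuous_quotient_mk'

theorem Glued.continuous_vadd (g : Fin m → ZMod 2) :
    Continuous (fun x : Glued P c I => g +ᵥ x) := by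
  refine continuous_quot_lift _ ?_
  exact Glued.continuous_mk.comp (continuous_fst.prodMk (continuous_const.add continuous_snd))

end Glued

/-! ### Panel structures and the glue-back construction -/

/-- Panels `P₁, …, P_k` on a space `X` with commuting free involutions `τᵢ : Pᵢ → Pᵢ`.
(That the panels of a nice manifold with corners are disjoint unions of facets is
not recorded: the gluing does not refer to it.) -/
structure PanelStructure (X : Type*) [TopologicalSpace X] (k : ℕ) where
  panel : Fin k → Set X
  isCompact_panel : ∀ i, IsCompact (panel i)
  τ : ∀ i, panel i → panel i
  continuous_τ : ∀ i, Continuous (τ i)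
  τ_τ : ∀ i x, τ i (τ i x) = x
  τ_ne : ∀ i x, τ i x ≠ x
  τ_mem : ∀ i j (x : panel i), (x : X) ∈ panel j → (τ i x : X) ∈ panel j
  τ_comm : ∀ i j (x : X) (hi : x ∈ panel i) (hj : x ∈ panel j),
    (τ i ⟨τ j ⟨x, hj⟩, τ_mem j i _ hi⟩ : X) = τ j ⟨τ i ⟨x, hi⟩, τ_mem i j _ hj⟩

section GlueBackSpace

variable {X : Type*} [TopologicalSpace X] {k m : ℕ}

/-- `(x, g) ∼ (τᵢ x, g + λ(Pᵢ))` for `x` in the panel `Pᵢ`. -/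
def glueRel (S : PanelStructure X k) (lam : Fin k → (Fin m → ZMod 2))
    (a b : X × (Fin m → ZMod 2)) : Prop :=
  ∃ (i : Fin k) (h : a.1 ∈ S.panel i), b.1 = S.τ i ⟨a.1, h⟩ ∧ b.2 = a.2 + lam i

/-- The glue-back space `M(X, {Pᵢ, τᵢ}, λ)` of a `(ℤ₂)ᵐ`-coloring `λ` of the panels: the quotient
of `X × (ℤ₂)ᵐ` by the equivalence relation generated by `glueRel`. -/
def GlueBackSpace (S : PanelStructure X k) (lam : Fin k → (Fin m → ZMod 2)) : Type _ :=
  Quotient (Relation.EqvGen.setoid (glueRel S lam))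

variable {S : PanelStructure X k} {lam : Fin k → (Fin m → ZMod 2)}

instance : TopologicalSpace (GlueBackSpace S lam) :=
  inferInstanceAs (TopologicalSpace (Quotient (Relation.EqvGen.setoid (glueRel S lam))))

/-- The quotient map `(x, g) ↦ [(x, g)]`. -/
def GlueBackSpace.mk (x : X) (g : Fin m → ZMod 2) : GlueBackSpace S lam :=
  Quotient.mk (Relation.EqvGen.setoid (glueRel S lam)) (x, g)

/-- Descent of a function that is compatible with the gluing. -/
def GlueBackSpace.lift {Y : Type*} (f : X × (Fin m → ZMod 2) → Y)
    (hf : ∀ a b, glueRel S lam a b → f a = f b) : GlueBackSpace S lam → Y :=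
  Quotient.lift (s := Relation.EqvGen.setoid (glueRel S lam)) f fun a b h => by
    have h' : Relation.EqvGen (glueRel S lam) a b := h
    clear h
    induction h' with
    | rel a b h => exact hf a b h
    | refl a => rfl
    | symm a b _ ih => exact ih.symm
    | trans a b d _ _ ih ih' => exact ih.trans ih'

/-- The natural action `g • [(x, g₀)] = [(x, g + g₀)]`. -/
instance : AddAction (Fin m → ZMod 2) (GlueBackSpace S lam) where
  vadd g := GlueBackSpace.lift (fun a => GlueBackSpace.mk a.1 (g + a.2)) (by
    rintro a b ⟨i, h, h1, h2⟩
    refine Quotient.sound (Relation.EqvGen.rel _ _ ⟨i, h, h1, ?_⟩)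
    simp only [h2, add_assoc])
  zero_vadd x := by
    induction x using Quotient.inductionOn with
    | h a => exact congrArg (Quotient.mk _) (Prod.ext rfl (zero_add a.2))
  add_vadd g h x := by
    induction x using Quotient.inductionOn with
    | h a => exact congrArg (Quotient.mk _) (Prod.ext rfl (add_assoc g h a.2))

/-- A coloring of `k` panels is maximally independent if its rank, the dimension of the span of
all its colors, is `k`. -/
def MaximallyIndependent (lam : Fin k → (Fin m → ZMod 2)) : Prop :=
  Module.finrank (ZMod 2) (Submodule.span (ZMod 2) (Set.range lam)) = k

end GlueBackSpace

/-! ### The small cover, its core, and the real moment-angle manifold -/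

section SmallCover

variable {n k : ℕ} {E : Type*} [NormedAddCommGroup E] [NormedSpace ℝ E]
  {P : SimplePolytope n k E}

/-- The small cover `Qⁿ` with characteristic function `μ`. -/
abbrev SmallCover (μ : CharFun P) : Type _ := Glued P μ.toFun Set.univ

/-- The core `Vⁿ`: the small cover cut open along the first `k` facets, that is, copies of the
polytope are glued only along the facets through `v₀`. -/
abbrev Core (μ : CharFun P) : Type _ := Glued P μ.toFun {i | k ≤ (i : ℕ)}

/-- The coloring `F i ↦ e i` by the standard basis. -/
def stdColor (n k : ℕ) (i : Fin (k + n)) : Fin (k + n) → ZMod 2 := Pi.single i 1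

variable (P) in
/-- The real moment-angle manifold `𝒵_P`. -/
abbrev RealMomentAngle : Type _ := Glued P (stdColor n k) Set.univ

theorem add_self_zmod_two {m : ℕ} (g : Fin m → ZMod 2) : g + g = 0 :=
  funext fun i => CharTwo.add_self_eq_zero (g i)

theorem isCompact_facet (P : SimplePolytope n k E) (i : Fin (k + n)) :
    IsCompact (P.facet i) := by
  have h : IsFacet n P.carrier (P.facet i) := by
    have : P.facet i ∈ Set.range P.facet := ⟨i, rfl⟩
    rwa [P.range_facet] at this
  obtain ⟨s, hs, hP⟩ := P.isPolytope
  refine h.2.1.isCompact ?_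
  rw [hP]
  exact hs.isCompact_convexHull ℝ

theorem facet_subset (P : SimplePolytope n k E) (i : Fin (k + n)) :
    P.facet i ⊆ P.carrier := by
  have h : IsFacet n P.carrier (P.facet i) := by
    have : P.facet i ∈ Set.range P.facet := ⟨i, rfl⟩
    rwa [P.range_facet] at this
  exact h.2.1.subset

/-- The color of a facet through `p` is not in the group of the remaining facets through `p`. -/
theorem CharFun.notMem_colorGroup (μ : CharFun P) (p : E) {i : Fin (k + n)}
    (hi : p ∈ P.facet i) {I : Set (Fin (k + n))} (hI : i ∉ I) :
    μ.toFun i ∉ colorGroup P μ.toFun I p := by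
  classical
  intro hmem
  have hind : LinearIndepOn (ZMod 2) μ.toFun
      ((Finset.univ.filter fun j => p ∈ P.facet j : Finset (Fin (k + n))) : Set _) :=
    μ.linearIndepOn _ ⟨p, by simp⟩
  have hspan : colorGroup P μ.toFun I p ≤
      (Submodule.span (ZMod 2) (μ.toFun '' {j | j ∈ I ∧ p ∈ P.facet j})).toAddSubgroup := by
    rw [colorGroup, AddSubgroup.closure_le]
    exact Submodule.subset_span
  have := (linearIndepOn_iff_notMem_span.1 hind) i (by simpa using hi)
  refine this (Submodule.span_mono (Set.image_mono ?_) (hspan hmem))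
  rintro j ⟨hj, hp⟩
  exact ⟨by simpa using hp, fun h => hI (h ▸ hj)⟩

/-- The panel `Pᵢ = ζ(Fᵢ × (ℤ₂)ⁿ)` of the core. -/
def corePanel (μ : CharFun P) (i : Fin k) : Set (Core μ) :=
  {x | (x.base : E) ∈ P.facet (Fin.castAdd n i)}

theorem isCompact_corePanel (μ : CharFun P) (i : Fin k) : IsCompact (corePanel μ i) := by
  have h1 : IsCompact ({p : P.carrier | (p : E) ∈ P.facet (Fin.castAdd n i)}) := by
    rw [Subtype.isCompact_iff]
    have h2 : (Subtype.val '' {p : P.carrier | (p : E) ∈ P.facet (Fin.castAdd n i)}) =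
        P.facet (Fin.castAdd n i) := by
      ext p
      constructor
      · rintro ⟨q, hq, rfl⟩
        exact hq
      · intro hp
        exact ⟨⟨p, facet_subset P _ hp⟩, hp, rfl⟩
    rw [h2]
    exact isCompact_facet P _
  have h3 := (h1.prod (isCompact_univ (X := Fin n → ZMod 2))).image
    (Glued.continuous_mk (P := P) (c := μ.toFun) (I := {i | k ≤ (i : ℕ)}))
  have h4 : corePanel μ i = (fun a : P.carrier × (Fin n → ZMod 2) => (Glued.mk a.1 a.2 : Core μ)) ''
      ({p : P.carrier | (p : E) ∈ P.facet (Fin.castAdd n i)} ×ˢ Set.univ) := by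
    ext x
    induction x using Glued.ind with
    | h p w =>
      constructor
      · intro h
        exact ⟨(p, w), ⟨h, trivial⟩, rfl⟩
      · rintro ⟨q, ⟨hq, -⟩, hx⟩
        rw [← hx]
        exact hq
  rw [h4]
  exact h3

theorem vadd_mem_corePanel (μ : CharFun P) (i : Fin k) (g : Fin n → ZMod 2) {x : Core μ}
    (hx : x ∈ corePanel μ i) : g +ᵥ x ∈ corePanel μ i := by
  change ((g +ᵥ x).base : E) ∈ P.facet (Fin.castAdd n i)
  rw [Glued.base_vadd]
  exact hx

/-- The panel structure of the core: `τᵢ [p, w] = [p, w + μ(Fᵢ)]` on `Pᵢ`. -/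
def corePanels (μ : CharFun P) : PanelStructure (Core μ) k where
  panel := corePanel μ
  isCompact_panel := isCompact_corePanel μ
  τ i x := ⟨μ.toFun (Fin.castAdd n i) +ᵥ (x : Core μ), vadd_mem_corePanel μ i _ x.2⟩
  continuous_τ i := ((Glued.continuous_vadd _).comp continuous_subtype_val).subtype_mk _
  τ_τ i x := by
    refine Subtype.ext ?_
    change _ +ᵥ (_ +ᵥ (x : Core μ)) = _
    rw [← add_vadd, add_self_zmod_two, zero_vadd]
  τ_ne i x h := by
    have h' := congrArg Subtype.val h
    obtain ⟨x, hx⟩ := x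
    induction x using Glued.ind with
    | h p w =>
      have h2 := (Glued.mk_eq_mk.1 h').2
      rw [add_sub_cancel_right] at h2
      exact μ.notMem_colorGroup p hx (by simp) h2
  τ_mem i j x h := vadd_mem_corePanel μ j _ h
  τ_comm i j x hi hj := vadd_comm _ _ x

/-- The basis `μ(F_{k+1}), …, μ(F_{k+n})` of `(ℤ₂)ⁿ`, the colors of the facets through `v₀`. -/
def CharFun.basis (μ : CharFun P) : Module.Basis (Fin n) (ZMod 2) (Fin n → ZMod 2) :=
  have h : LinearIndependent (ZMod 2) fun j : Fin n => μ.toFun (Fin.natAdd k j) := by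
    classical
    have h1 := μ.linearIndepOn (Finset.univ.filter fun j => k ≤ (j : ℕ)) ⟨P.v₀, by
      simp only [Set.mem_iInter, Finset.mem_filter, Finset.mem_univ, true_and]
      exact fun i hi => (P.v₀_mem_facet_iff i).2 hi⟩
    exact LinearIndependent.comp h1
      (fun j : Fin n => ⟨Fin.natAdd k j, by simp⟩)
      (fun a b hab => by simpa using hab)
  Module.Basis.mk h (h.span_eq_top_of_card_eq_finrank' (by simp)).ge

/-- The embedding `(ℤ₂)ⁿ → (ℤ₂)ᵏ⁺ⁿ` that identifies `μ(F_{k+j})` with `e_{k+j}`. -/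
def CharFun.embed (μ : CharFun P) : (Fin n → ZMod 2) →ₗ[ZMod 2] (Fin (k + n) → ZMod 2) :=
  μ.basis.constr (ZMod 2) fun j => stdColor n k (Fin.natAdd k j)

/-- The element `eᵢ + μ(Fᵢ)` of `(ℤ₂)ᵏ⁺ⁿ`, for `i ≤ k`. -/
def CharFun.gen (μ : CharFun P) (i : Fin k) : Fin (k + n) → ZMod 2 :=
  stdColor n k (Fin.castAdd n i) + μ.embed (μ.toFun (Fin.castAdd n i))

/-- The subgroup `H_μ` generated by the elements `eᵢ + μ(Fᵢ)`, for `i ≤ k`. -/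
def CharFun.H (μ : CharFun P) : AddSubgroup (Fin (k + n) → ZMod 2) :=
  AddSubgroup.closure (Set.range μ.gen)

/-- The homomorphism `(ℤ₂)ᵏ⁺ⁿ → (ℤ₂)ⁿ` with `eᵢ ↦ μ(Fᵢ)` for all facets. -/
def CharFun.hom (μ : CharFun P) : (Fin (k + n) → ZMod 2) →ₗ[ZMod 2] (Fin n → ZMod 2) :=
  Fintype.linearCombination (ZMod 2) μ.toFun

/-- The map `Vⁿ → Qⁿ`, `[p, w] ↦ [p, w]`, that glues the core back to the small cover. -/
def coreToCover (μ : CharFun P) : Core μ → SmallCover μ :=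
  Quotient.map (sa := gluedSetoid P μ.toFun {i | k ≤ (i : ℕ)})
    (sb := gluedSetoid P μ.toFun Set.univ) id
    (by
      rintro a b ⟨h1, h2⟩
      refine ⟨h1, ?_⟩
      have hle : colorGroup P μ.toFun {i | k ≤ (i : ℕ)} (a.1 : E) ≤
          colorGroup P μ.toFun Set.univ (a.1 : E) :=
        AddSubgroup.closure_mono (Set.image_mono fun _ hi => ⟨trivial, hi.2⟩)
      exact hle h2)

theorem coreToCover_vadd (μ : CharFun P) (i : Fin k) (x : Core μ) (hx : x ∈ corePanel μ i) :
    coreToCover μ x = coreToCover μ (μ.toFun (Fin.castAdd n i) +ᵥ x) := by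
  induction x using Glued.ind with
  | h p w =>
    change (Glued.mk p w : SmallCover μ) = Glued.mk p (μ.toFun (Fin.castAdd n i) + w)
    rw [Glued.mk_eq_mk]
    refine ⟨rfl, ?_⟩
    rw [← neg_sub, add_sub_cancel_right]
    exact AddSubgroup.neg_mem _ (AddSubgroup.subset_closure ⟨_, ⟨trivial, hx⟩, rfl⟩)

/-- The projection `M(Vⁿ, λ) → Qⁿ`, `[(x, g)] ↦ [x]`. -/
def glueBackProj {m : ℕ} (μ : CharFun P) (lam : Fin k → (Fin m → ZMod 2)) :
    GlueBackSpace (corePanels μ) lam → SmallCover μ :=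
  GlueBackSpace.lift (fun a => coreToCover μ a.1) (by
    rintro ⟨x, g⟩ ⟨y, g'⟩ ⟨i, h, h1, -⟩
    dsimp only at h h1
    rw [h1]
    exact coreToCover_vadd μ i x h)

/-- The projection `𝒵_P → Qⁿ`, `[p, g] ↦ [p, ∑ gᵢ μ(Fᵢ)]`. -/
def momentAngleProj (μ : CharFun P) : RealMomentAngle P → SmallCover μ :=
  Quotient.map (sa := gluedSetoid P (stdColor n k) Set.univ)
    (sb := gluedSetoid P μ.toFun Set.univ) (fun a => (a.1, μ.hom a.2)) (by
    rintro ⟨p, g⟩ ⟨p', g'⟩ ⟨h1, h2⟩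
    refine ⟨h1, ?_⟩
    dsimp only at h2 ⊢
    rw [← map_sub]
    have : colorGroup P (stdColor n k) Set.univ (p : E) ≤
        (colorGroup P μ.toFun Set.univ (p : E)).comap μ.hom.toAddMonoidHom := by
      rw [colorGroup, AddSubgroup.closure_le]
      rintro _ ⟨i, hi, rfl⟩
      refine AddSubgroup.subset_closure ⟨i, hi, ?_⟩
      simp [CharFun.hom, stdColor]
    exact this h2)

theorem glueBackProj_vadd {m : ℕ} (μ : CharFun P) (lam : Fin k → (Fin m → ZMod 2))
    (g : Fin m → ZMod 2) (x : GlueBackSpace (corePanels μ) lam) :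
    glueBackProj μ lam (g +ᵥ x) = glueBackProj μ lam x := by
  induction x using Quotient.inductionOn with
  | h a => rfl

theorem momentAngleProj_vadd (μ : CharFun P) (h : μ.H) (x : RealMomentAngle P) :
    momentAngleProj μ (h +ᵥ x) = momentAngleProj μ x := by
  have key : μ.H ≤ μ.hom.toAddMonoidHom.ker := by
    rw [CharFun.H, AddSubgroup.closure_le]
    rintro _ ⟨i, rfl⟩
    have h2 : ∀ w, μ.hom (μ.embed w) = w := by
      intro w
      have : μ.hom.comp μ.embed = LinearMap.id := by
        refine μ.basis.ext fun j => ?_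
        simp only [LinearMap.comp_apply, CharFun.embed, Module.Basis.constr_basis]
        simp [CharFun.hom, stdColor, CharFun.basis]
      exact LinearMap.congr_fun this w
    change μ.hom (μ.gen i) = 0
    rw [CharFun.gen, map_add, h2]
    simp [CharFun.hom, stdColor, add_self_zmod_two]
  induction x using Glued.ind with
  | h p w =>
    have h0 : μ.hom (h : Fin (k + n) → ZMod 2) = 0 := key h.2
    change Glued.mk p (μ.hom ((h : Fin (k + n) → ZMod 2) + w)) = Glued.mk p (μ.hom w)
    rw [map_add, h0, zero_add]

end SmallCover

/-! ### Orbit spaces and equivalence of free actions -/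

section Orbit

variable {G : Type*} [AddCommGroup G] {X : Type*} [AddAction G X]

/-- The orbit space `X / N`, with the quotient topology. -/
def OrbitSpace (N : AddSubgroup G) (X : Type*) [AddAction G X] : Type _ :=
  Quotient (AddAction.orbitRel N X)

variable {N : AddSubgroup G}

instance [TopologicalSpace X] : TopologicalSpace (OrbitSpace N X) :=
  inferInstanceAs (TopologicalSpace (Quotient (AddAction.orbitRel N X)))

/-- The class `[x]`. -/
def OrbitSpace.mk (x : X) : OrbitSpace N X := Quotient.mk (AddAction.orbitRel N X) x

/-- The induced action of `G / N` on `X / N`, `[g] • [x] = [g • x]`. -/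
instance : AddAction (G ⧸ N) (OrbitSpace N X) where
  vadd q := Quotient.map (sa := AddAction.orbitRel N X) (sb := AddAction.orbitRel N X)
    (fun x => q.out +ᵥ x) (by
      rintro a b ⟨h, rfl⟩
      exact ⟨h, vadd_comm h q.out b⟩)
  zero_vadd x := by
    induction x using Quotient.inductionOn with
    | h a =>
      refine Quotient.sound ⟨⟨(0 : G ⧸ N).out, ?_⟩, rfl⟩
      rw [← QuotientAddGroup.eq_zero_iff, QuotientAddGroup.out_eq']
  add_vadd q r x := by
    induction x using Quotient.inductionOn with
    | h a =>
      refine Quotient.sound ⟨⟨(q + r).out - (q.out + r.out), ?_⟩, ?_⟩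
      · rw [← QuotientAddGroup.eq_zero_iff]
        simp
      · change ((q + r).out - (q.out + r.out)) +ᵥ (q.out +ᵥ (r.out +ᵥ a)) = (q + r).out +ᵥ a
        rw [← add_vadd, ← add_vadd]
        congr 1
        abel

/-- The map `X / N → Q` induced by a `G`-invariant map `X → Q`. -/
def OrbitSpace.desc {Q : Type*} (N : AddSubgroup G) (π : X → Q)
    (hπ : ∀ (g : G) (x : X), π (g +ᵥ x) = π x) : OrbitSpace N X → Q :=
  Quotient.lift (s := AddAction.orbitRel N X) π (by
    rintro a b ⟨h, rfl⟩
    exact hπ h b)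

/-- `π : X → Q` and `π' : X' → Q` are principal bundles with discrete structure groups `G`
and `G'` (the actions are free, with orbit maps `π` and `π'`), and they are equivalent along the
group isomorphism `σ`: there is a homeomorphism `f : X → X'` with `f (g • x) = σ g • f x` that
induces the identity on the common orbit space `Q`. -/
def EquivalentActions {G G' X X' Q : Type*} [AddGroup G] [AddGroup G'] [TopologicalSpace X]
    [TopologicalSpace X'] [TopologicalSpace Q] [AddAction G X] [AddAction G' X']
    (π : X → Q) (π' : X' → Q) (σ : G ≃+ G') : Prop :=
  IsAddQuotientCoveringMap π G ∧ IsAddQuotientCoveringMap π' G' ∧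
    ∃ f : X ≃ₜ X', (∀ (g : G) (x : X), f (g +ᵥ x) = σ g +ᵥ f x) ∧ ∀ x, π' (f x) = π x

end Orbit

end GlueBack

end

open GlueBack

open GlueBack

noncomputable section

namespace GlueBack

/-! ### Free actions, their quotients and equivalences -/

section Orbit

open Topology

variable {G : Type*} [AddCommGroup G] {X : Type*} [AddAction G X] {N : AddSubgroup G}

/-! The facets through `v₀` give a basis of `(ℤ₂)ⁿ`, so `hom : eᵢ ↦ μ(Fᵢ)` is split by `embed`, its
kernel is `H_μ`, and `(ℤ₂)ᵏ⁺ⁿ` is the direct sum of the embedded `(ℤ₂)ⁿ` and `H_μ`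
(`CharFun.embed_hom_add_genHom`, `CharFun.mem_H_iff`). A maximally independent coloring is a basis
of `(ℤ₂)ᵏ`, hence identifies `(ℤ₂)ᵏ` with `H_μ`.

In these coordinates `x` becomes the pair `(hom x, colorHom x)`. For a facet through `v₀`, `eⱼ`
becomes `(μ(Fⱼ), 0)`, an identification made in the core; for the other facets, `eᵢ` becomes
`(μ(Fᵢ), λ(Pᵢ))`, the gluing by `τᵢ`. So both spaces are the same quotient of copies of the polytope
(`glueBack_mk_eq_of_mem`, `glueBackHomeomorph`).

The action of `H_μ` is free because the values of `μ` at a point are independent, so `ker hom` meets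
every stabilizer trivially (`CharFun.eq_zero_of_mem_colorGroup`); small neighborhoods come from
`Glued.exists_nhds`. The bundle structure is transported to the glue-back space, and everything
descends to quotients by subgroups (`EquivalentActions.orbitSpace`). -/

theorem OrbitSpace.ind {C : OrbitSpace N X → Prop} (h : ∀ x, C (OrbitSpace.mk x))
    (x : OrbitSpace N X) : C x :=
  Quotient.inductionOn x h

theorem OrbitSpace.mk_eq_mk {x y : X} :
    (OrbitSpace.mk x : OrbitSpace N X) = OrbitSpace.mk y ↔ ∃ g ∈ N, g +ᵥ y = x := by
  constructor
  · intro h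
    obtain ⟨g, hg⟩ := Quotient.exact h
    exact ⟨g, g.2, hg⟩
  · rintro ⟨g, hg, h⟩
    exact Quotient.sound ⟨⟨g, hg⟩, h⟩

/-- The action is defined through the representative `Quotient.out`, which differs from `g` by an
element of `N`. -/
theorem OrbitSpace.coe_vadd_mk (g : G) (x : X) :
    (g : G ⧸ N) +ᵥ (OrbitSpace.mk x : OrbitSpace N X) = OrbitSpace.mk (g +ᵥ x) := by
  change OrbitSpace.mk ((g : G ⧸ N).out +ᵥ x) = _
  rw [OrbitSpace.mk_eq_mk]
  refine ⟨(g : G ⧸ N).out - g, ?_, ?_⟩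
  · rw [← QuotientAddGroup.eq_zero_iff]
    simp
  · rw [← add_vadd, sub_add_cancel]

theorem OrbitSpace.isQuotientMap_mk [TopologicalSpace X] :
    IsQuotientMap (OrbitSpace.mk : X → OrbitSpace N X) :=
  isQuotientMap_quotient_mk'

theorem OrbitSpace.isOpenMap_mk [TopologicalSpace X] [ContinuousConstVAdd G X] :
    IsOpenMap (OrbitSpace.mk : X → OrbitSpace N X) :=
  have : ContinuousConstVAdd N X := ⟨fun g => continuous_const_vadd (g : G)⟩
  isOpenMap_quotient_mk'_add

/-- The orbit map of a free action of an abelian group remains one after dividing by a subgroup. -/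
theorem OrbitSpace.isAddQuotientCoveringMap_desc {Q : Type*} [TopologicalSpace X]
    [TopologicalSpace Q] {π : X → Q} (h : IsAddQuotientCoveringMap π G) (N : AddSubgroup G)
    (hπ : ∀ (g : G) (x : X), π (g +ᵥ x) = π x) :
    IsAddQuotientCoveringMap (OrbitSpace.desc N π hπ) (G ⧸ N) where
  toIsQuotientMap := by
    have hc : Continuous (OrbitSpace.desc N π hπ) := continuous_quot_lift _ h.continuous
    exact IsQuotientMap.of_comp OrbitSpace.isQuotientMap_mk.continuous hc h.toIsQuotientMap
  continuous_const_vadd q := by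
    induction q using QuotientAddGroup.induction_on with
    | H g =>
      rw [OrbitSpace.isQuotientMap_mk.continuous_iff]
      have : (fun x : OrbitSpace N X => (g : G ⧸ N) +ᵥ x) ∘ OrbitSpace.mk =
          OrbitSpace.mk ∘ fun x => g +ᵥ x :=
        funext fun x => OrbitSpace.coe_vadd_mk g x
      rw [this]
      exact OrbitSpace.isQuotientMap_mk.continuous.comp (h.continuous_const_vadd g)
  apply_eq_iff_mem_orbit {x y} := by
    induction x using OrbitSpace.ind with
    | h x =>
    induction y using OrbitSpace.ind with
    | h y =>
    change π x = π y ↔ _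
    rw [h.apply_eq_iff_mem_orbit]
    constructor
    · rintro ⟨g, rfl⟩
      exact ⟨(g : G ⧸ N), OrbitSpace.coe_vadd_mk g y⟩
    · rintro ⟨q, hq⟩
      induction q using QuotientAddGroup.induction_on with
      | H g =>
        obtain ⟨s, -, hs⟩ := OrbitSpace.mk_eq_mk.1 ((OrbitSpace.coe_vadd_mk g y).symm.trans hq)
        -- Here `s +ᵥ x = g +ᵥ y` with `s` in `N`, so `-s + g` carries `y` to `x`.
        refine ⟨-s + g, ?_⟩
        change (-s + g) +ᵥ y = x
        rw [add_vadd, ← hs, neg_vadd_vadd]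
  disjoint x := by
    induction x using OrbitSpace.ind with
    | h x =>
    have := h.toContinuousConstVAdd
    obtain ⟨U, hU, hd⟩ := h.disjoint x
    refine ⟨OrbitSpace.mk '' U, OrbitSpace.isOpenMap_mk.image_mem_nhds hU, fun q => ?_⟩
    induction q using QuotientAddGroup.induction_on with
    | H g =>
      rintro ⟨_, ⟨_, ⟨u, hu, rfl⟩, rfl⟩, v, hv, huv⟩
      obtain ⟨s, hs, hsv⟩ := OrbitSpace.mk_eq_mk.1 (huv.trans (OrbitSpace.coe_vadd_mk g u))
      -- Two points of the image of `U` related by the class of `g` lift to points of `U` related by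
      -- `s + g`; hence `s + g` is trivial and `g` lies in `N`.
      have h0 : s + g = 0 := hd _ ⟨v, ⟨u, hu, by rw [← hsv, ← add_vadd]⟩, hv⟩
      rw [QuotientAddGroup.eq_zero_iff, eq_neg_of_add_eq_zero_right h0]
      exact N.neg_mem hs

variable {G' : Type*} [AddCommGroup G'] {X' : Type*} [AddAction G' X']

/-- An equivariant homeomorphism induces a homeomorphism of orbit spaces. -/
def OrbitSpace.homeomorph [TopologicalSpace X] [TopologicalSpace X'] (N : AddSubgroup G)
    (σ : G ≃+ G') (f : X ≃ₜ X') (hf : ∀ (g : G) (x : X), f (g +ᵥ x) = σ g +ᵥ f x) :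
    OrbitSpace N X ≃ₜ OrbitSpace (N.map (σ : G →+ G')) X' where
  toFun := Quotient.map (sa := AddAction.orbitRel N X)
    (sb := AddAction.orbitRel (N.map (σ : G →+ G')) X') f (by
      rintro a b ⟨g, rfl⟩
      exact ⟨⟨σ g, g, g.2, rfl⟩, (hf g b).symm⟩)
  invFun := Quotient.map (sa := AddAction.orbitRel (N.map (σ : G →+ G')) X')
    (sb := AddAction.orbitRel N X) f.symm (by
      rintro a b ⟨⟨_, g, hg, rfl⟩, rfl⟩
      refine ⟨⟨g, hg⟩, f.injective ?_⟩
      exact (hf g _).trans (by simp))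
  left_inv := OrbitSpace.ind fun x => congrArg OrbitSpace.mk (f.symm_apply_apply x)
  right_inv := OrbitSpace.ind fun x => congrArg OrbitSpace.mk (f.apply_symm_apply x)
  continuous_toFun := continuous_quot_lift _
    (OrbitSpace.isQuotientMap_mk.continuous.comp f.continuous)
  continuous_invFun := continuous_quot_lift _
    (OrbitSpace.isQuotientMap_mk.continuous.comp f.symm.continuous)

/-- Being the orbit map of a free action passes along an equivariant homeomorphism. -/
theorem isAddQuotientCoveringMap_of_homeomorph {Q : Type*} [TopologicalSpace X]
    [TopologicalSpace X'] [TopologicalSpace Q] {π : X → Q} {π' : X' → Q} (σ : G ≃+ G')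
    (f : X ≃ₜ X') (hf : ∀ (g : G) (x : X), f (g +ᵥ x) = σ g +ᵥ f x)
    (hπ : ∀ x, π' (f x) = π x) (h : IsAddQuotientCoveringMap π' G') :
    IsAddQuotientCoveringMap π G where
  toIsQuotientMap := by
    have : π = π' ∘ f := funext fun x => (hπ x).symm
    rw [this]
    exact h.toIsQuotientMap.comp f.isQuotientMap
  continuous_const_vadd g := by
    rw [← f.comp_continuous_iff]
    have : f ∘ (fun x => g +ᵥ x) = (fun x => σ g +ᵥ x) ∘ f := funext fun x => hf g x
    rw [this]
    exact (h.continuous_const_vadd _).comp f.continuous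
  apply_eq_iff_mem_orbit {x y} := by
    rw [← hπ, ← hπ, h.apply_eq_iff_mem_orbit]
    constructor
    · rintro ⟨g, hg⟩
      refine ⟨σ.symm g, f.injective ?_⟩
      change f (σ.symm g +ᵥ y) = f x
      rw [hf, σ.apply_symm_apply]
      exact hg
    · rintro ⟨g, rfl⟩
      exact ⟨σ g, (hf g y).symm⟩
  disjoint x := by
    obtain ⟨U, hU, hd⟩ := h.disjoint (f x)
    refine ⟨f ⁻¹' U, f.continuous.continuousAt.preimage_mem_nhds hU, fun g => ?_⟩
    rintro ⟨_, ⟨u, hu, rfl⟩, hgu⟩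
    refine σ.map_eq_zero_iff.1 (hd (σ g) ⟨f (g +ᵥ u), ⟨f u, hu, (hf g u).symm⟩, hgu⟩)

/-- Purely formal: the coverings and the equivariant homeomorphism all descend, since the
homeomorphism carries `N`-orbits to `σ(N)`-orbits. -/
theorem EquivalentActions.orbitSpace {Q : Type*} [TopologicalSpace X] [TopologicalSpace X']
    [TopologicalSpace Q] {π : X → Q} {π' : X' → Q} {σ : G ≃+ G'}
    (h : EquivalentActions π π' σ) (hπ : ∀ (g : G) (x : X), π (g +ᵥ x) = π x)
    (hπ' : ∀ (g : G') (x : X'), π' (g +ᵥ x) = π' x) (N : AddSubgroup G) :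
    EquivalentActions (OrbitSpace.desc N π hπ)
      (OrbitSpace.desc (N.map (σ : G →+ G')) π' hπ')
      (QuotientAddGroup.congr N (N.map (σ : G →+ G')) σ rfl) := by
  obtain ⟨h1, h2, f, hf, hfπ⟩ := h
  refine ⟨OrbitSpace.isAddQuotientCoveringMap_desc h1 N hπ,
    OrbitSpace.isAddQuotientCoveringMap_desc h2 _ hπ', OrbitSpace.homeomorph N σ f hf, ?_,
    OrbitSpace.ind hfπ⟩
  intro q x
  induction q using QuotientAddGroup.induction_on with
  | H g =>
  induction x using OrbitSpace.ind with
  | h x =>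
  rw [OrbitSpace.coe_vadd_mk]
  change OrbitSpace.mk (f (g +ᵥ x)) =
    ((σ g : G') : G' ⧸ N.map (σ : G →+ G')) +ᵥ OrbitSpace.mk (f x)
  rw [OrbitSpace.coe_vadd_mk, hf]

end Orbit

variable {n k : ℕ} {E : Type*} [NormedAddCommGroup E] [NormedSpace ℝ E]
  {P : SimplePolytope n k E}

/-! ### The splitting of `(ℤ₂)ᵏ⁺ⁿ` determined by a characteristic function -/

theorem CharFun.hom_stdColor (μ : CharFun P) (i : Fin (k + n)) :
    μ.hom (stdColor n k i) = μ.toFun i := by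
  simp [CharFun.hom, stdColor]

theorem CharFun.embed_toFun_natAdd (μ : CharFun P) (j : Fin n) :
    μ.embed (μ.toFun (Fin.natAdd k j)) = stdColor n k (Fin.natAdd k j) := by
  have h : μ.toFun (Fin.natAdd k j) = μ.basis j := by simp [CharFun.basis]
  rw [h, CharFun.embed, Module.Basis.constr_basis]

/-- It suffices to check the basis `μ(F_{k+j})`, which `embed` sends to `e_{k+j}` and `hom` sends
back. -/
theorem CharFun.hom_embed (μ : CharFun P) (w : Fin n → ZMod 2) : μ.hom (μ.embed w) = w := by
  have : μ.hom.comp μ.embed = LinearMap.id := by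
    refine μ.basis.ext fun j => ?_
    have h : μ.basis j = μ.toFun (Fin.natAdd k j) := by simp [CharFun.basis]
    rw [LinearMap.comp_apply, h, μ.embed_toFun_natAdd, μ.hom_stdColor, LinearMap.id_apply]
  exact LinearMap.congr_fun this w

theorem CharFun.hom_gen (μ : CharFun P) (i : Fin k) : μ.hom (μ.gen i) = 0 := by
  rw [CharFun.gen, map_add, μ.hom_embed, μ.hom_stdColor, add_self_zmod_two]

/-- The restriction of an element of `(ℤ₂)ᵏ⁺ⁿ` to the first `k` coordinates. -/
def restrictFirst (n k : ℕ) : (Fin (k + n) → ZMod 2) →ₗ[ZMod 2] (Fin k → ZMod 2) :=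
  LinearMap.funLeft (ZMod 2) (ZMod 2) (Fin.castAdd n)

theorem restrictFirst_stdColor_castAdd (i : Fin k) :
    restrictFirst n k (stdColor n k (Fin.castAdd n i)) = Pi.single i 1 := by
  ext j
  simp [restrictFirst, LinearMap.funLeft_apply, stdColor, Pi.single_apply]

theorem restrictFirst_stdColor_natAdd (j : Fin n) :
    restrictFirst n k (stdColor n k (Fin.natAdd k j)) = 0 := by
  ext i
  have h : Fin.castAdd n i ≠ Fin.natAdd k j := by
    intro h
    have := congrArg Fin.val h
    simp at this
    omega
  simp [restrictFirst, LinearMap.funLeft_apply, stdColor, h]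

theorem CharFun.restrictFirst_embed (μ : CharFun P) (w : Fin n → ZMod 2) :
    restrictFirst n k (μ.embed w) = 0 := by
  have : (restrictFirst n k).comp μ.embed = 0 := by
    refine μ.basis.ext fun j => ?_
    rw [LinearMap.comp_apply, CharFun.embed, Module.Basis.constr_basis,
      restrictFirst_stdColor_natAdd, LinearMap.zero_apply]
  exact LinearMap.congr_fun this w

/-- The homomorphism `(ℤ₂)ᵏ → (ℤ₂)ᵏ⁺ⁿ` with `eᵢ ↦ eᵢ + μ(Fᵢ)`. -/
def CharFun.genHom (μ : CharFun P) : (Fin k → ZMod 2) →ₗ[ZMod 2] (Fin (k + n) → ZMod 2) :=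
  Fintype.linearCombination (ZMod 2) μ.gen

theorem CharFun.genHom_single (μ : CharFun P) (i : Fin k) :
    μ.genHom (Pi.single i 1) = μ.gen i := by
  simp [CharFun.genHom]

/-- The summand `embed (μ(Fᵢ))` of `gen i` involves only the last `n` coordinates. Hence the
generators of `H_μ` are independent and its rank is `k`. -/
theorem CharFun.restrictFirst_genHom (μ : CharFun P) (y : Fin k → ZMod 2) :
    restrictFirst n k (μ.genHom y) = y := by
  have : (restrictFirst n k).comp μ.genHom = LinearMap.id := by
    refine (Pi.basisFun (ZMod 2) (Fin k)).ext fun i => ?_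
    rw [Pi.basisFun_apply, LinearMap.comp_apply, μ.genHom_single, CharFun.gen, map_add,
      μ.restrictFirst_embed, restrictFirst_stdColor_castAdd, add_zero, LinearMap.id_apply]
  exact LinearMap.congr_fun this y

theorem CharFun.genHom_mem (μ : CharFun P) (y : Fin k → ZMod 2) : μ.genHom y ∈ μ.H := by
  rw [CharFun.genHom, Fintype.linearCombination_apply]
  exact AddSubgroup.sum_mem _ fun i _ =>
    ZMod.smul_mem (AddSubgroup.subset_closure (Set.mem_range_self i)) _

theorem CharFun.hom_eq_zero (μ : CharFun P) {x : Fin (k + n) → ZMod 2} (hx : x ∈ μ.H) :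
    μ.hom x = 0 := by
  have h : μ.H ≤ μ.hom.toAddMonoidHom.ker := by
    rw [CharFun.H, AddSubgroup.closure_le]
    rintro _ ⟨i, rfl⟩
    exact μ.hom_gen i
  exact h hx

/-- `(ℤ₂)ᵏ⁺ⁿ` is the sum of the embedded `(ℤ₂)ⁿ` and `H_μ`. -/
theorem CharFun.embed_hom_add_genHom (μ : CharFun P) (x : Fin (k + n) → ZMod 2) :
    μ.embed (μ.hom x) + μ.genHom (restrictFirst n k x) = x := by
  have : μ.embed.comp μ.hom + μ.genHom.comp (restrictFirst n k) = LinearMap.id := by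
    refine (Pi.basisFun (ZMod 2) (Fin (k + n))).ext fun i => ?_
    rw [Pi.basisFun_apply, LinearMap.add_apply, LinearMap.comp_apply, LinearMap.comp_apply,
      LinearMap.id_apply]
    change μ.embed (μ.hom (stdColor n k i)) + μ.genHom (restrictFirst n k (stdColor n k i)) =
      stdColor n k i
    rw [μ.hom_stdColor]
    -- For `i ≤ k`, `eᵢ` is `μ(Fᵢ)` plus `eᵢ + μ(Fᵢ)` in characteristic 2; for a facet through `v₀`
    -- the second summand vanishes.
    induction i using Fin.addCases with
    | left i =>
      rw [restrictFirst_stdColor_castAdd, μ.genHom_single, CharFun.gen, add_left_comm,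
        add_self_zmod_two, add_zero]
    | right j =>
      rw [restrictFirst_stdColor_natAdd, map_zero, add_zero, μ.embed_toFun_natAdd]
  exact LinearMap.congr_fun this x

theorem CharFun.mem_H_iff (μ : CharFun P) {x : Fin (k + n) → ZMod 2} :
    x ∈ μ.H ↔ μ.hom x = 0 := by
  refine ⟨μ.hom_eq_zero, fun h => ?_⟩
  rw [← μ.embed_hom_add_genHom x, h, map_zero, zero_add]
  exact μ.genHom_mem _

/-- The isomorphism `(ℤ₂)ᵏ ≃ H_μ` with `eᵢ ↦ eᵢ + μ(Fᵢ)`. -/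
def CharFun.genEquiv (μ : CharFun P) : (Fin k → ZMod 2) ≃+ μ.H where
  toFun y := ⟨μ.genHom y, μ.genHom_mem y⟩
  invFun x := restrictFirst n k x
  left_inv := μ.restrictFirst_genHom
  right_inv x := Subtype.ext (by
    have h := μ.embed_hom_add_genHom (x : Fin (k + n) → ZMod 2)
    rwa [μ.hom_eq_zero x.2, map_zero, zero_add] at h)
  map_add' y z := Subtype.ext (map_add μ.genHom y z)

/-- The basis of `(ℤ₂)ᵏ` formed by the colors of a maximally independent coloring. -/
def MaximallyIndependent.basis {lam : Fin k → (Fin k → ZMod 2)} (h : MaximallyIndependent lam) :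
    Module.Basis (Fin k) (ZMod 2) (Fin k → ZMod 2) :=
  have hi : LinearIndependent (ZMod 2) lam :=
    linearIndependent_iff_card_eq_finrank_span.2 (by
      rw [Fintype.card_fin]
      exact Eq.symm h)
  Module.Basis.mk hi (hi.span_eq_top_of_card_eq_finrank' (by simp)).ge

/-- The isomorphism `σ : (ℤ₂)ᵏ ≃ H_μ` with `λ(Pᵢ) ↦ eᵢ + μ(Fᵢ)`. -/
def CharFun.colorEquiv (μ : CharFun P) {lam : Fin k → (Fin k → ZMod 2)}
    (h : MaximallyIndependent lam) : (Fin k → ZMod 2) ≃+ μ.H :=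
  h.basis.equivFun.toAddEquiv.trans μ.genEquiv

theorem CharFun.colorEquiv_apply (μ : CharFun P) {lam : Fin k → (Fin k → ZMod 2)}
    (h : MaximallyIndependent lam) (i : Fin k) :
    (μ.colorEquiv h (lam i) : Fin (k + n) → ZMod 2) = μ.gen i := by
  have hi : lam i = h.basis i := by simp [MaximallyIndependent.basis]
  change μ.genHom (h.basis.equivFun (lam i)) = μ.gen i
  rw [hi, ← μ.genHom_single i]
  congr 1
  ext j
  simp [Pi.single_apply, eq_comm]

/-! ### Color groups and the covering `𝒵_P → Qⁿ` -/

theorem color_mem_colorGroup {m : ℕ} {c : Fin (k + n) → (Fin m → ZMod 2)}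
    {I : Set (Fin (k + n))} {p : E} {i : Fin (k + n)} (hi : i ∈ I) (hp : p ∈ P.facet i) :
    c i ∈ colorGroup P c I p :=
  AddSubgroup.subset_closure ⟨i, ⟨hi, hp⟩, rfl⟩

/-- The generators correspond under `hom`. This lifts an identification in `Qⁿ` to one in `𝒵_P`. -/
theorem CharFun.map_colorGroup_stdColor (μ : CharFun P) (p : E) :
    (colorGroup P (stdColor n k) Set.univ p).map μ.hom.toAddMonoidHom =
      colorGroup P μ.toFun Set.univ p := by
  rw [colorGroup, colorGroup, AddMonoidHom.map_closure, Set.image_image]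
  congr 1
  exact Set.image_congr fun i _ => μ.hom_stdColor i

theorem eq_zero_of_mem_colorGroup_stdColor {p : E} {x : Fin (k + n) → ZMod 2}
    (hx : x ∈ colorGroup P (stdColor n k) Set.univ p) {i : Fin (k + n)} (hi : p ∉ P.facet i) :
    x i = 0 := by
  have h : colorGroup P (stdColor n k) Set.univ p ≤
      (Pi.evalAddMonoidHom (fun _ : Fin (k + n) => ZMod 2) i).ker := by
    rw [colorGroup, AddSubgroup.closure_le]
    rintro _ ⟨j, ⟨-, hj⟩, rfl⟩
    have hij : i ≠ j := fun h => hi (h ▸ hj)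
    change stdColor n k j i = 0
    simp [stdColor, hij]
  exact h hx

/-- The colors at a point being independent, `H_μ` meets the stabilizers trivially. -/
theorem CharFun.eq_zero_of_mem_colorGroup (μ : CharFun P) {p : E} {x : Fin (k + n) → ZMod 2}
    (hx : x ∈ colorGroup P (stdColor n k) Set.univ p) (h : μ.hom x = 0) : x = 0 := by
  classical
  have hind := μ.linearIndepOn (Finset.univ.filter fun j => p ∈ P.facet j) ⟨p, by simp⟩
  rw [linearIndepOn_finset_iff] at hind
  -- The coordinates of `x` off the facets through `p` vanish, so `hom x = 0` is a linear relation
  -- among independent vectors.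
  have hsum : ∑ i ∈ Finset.univ.filter (fun j => p ∈ P.facet j), x i • μ.toFun i = 0 := by
    rw [← h, CharFun.hom, Fintype.linearCombination_apply]
    refine Finset.sum_subset (Finset.subset_univ _) fun i _ hi => ?_
    rw [eq_zero_of_mem_colorGroup_stdColor hx (by simpa using hi), zero_smul]
  funext i
  by_cases hi : p ∈ P.facet i
  · exact hind x hsum i (by simpa using hi)
  · exact eq_zero_of_mem_colorGroup_stdColor hx hi

/-! ### Neighborhoods in glued spaces -/

theorem Glued.isQuotientMap_mk {m : ℕ} {c : Fin (k + n) → (Fin m → ZMod 2)}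
    {I : Set (Fin (k + n))} :
    Topology.IsQuotientMap
      (fun a : P.carrier × (Fin m → ZMod 2) => (Glued.mk a.1 a.2 : Glued P c I)) :=
  isQuotientMap_quotient_mk'

/-- The points of the polytope that lie on no facet avoiding `p`. -/
def openStar (P : SimplePolytope n k E) (p : P.carrier) : Set P.carrier :=
  {q | ∀ i, (p : E) ∉ P.facet i → (q : E) ∉ P.facet i}

/-- Only finitely many facets, each closed, are removed. -/
theorem isOpen_openStar (p : P.carrier) : IsOpen (openStar P p) := by
  have h : openStar P p =
      ⋂ i : {i // (p : E) ∉ P.facet i}, {q : P.carrier | (q : E) ∈ P.facet i}ᶜ := by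
    ext q
    simp [openStar]
  rw [h]
  exact isOpen_iInter_of_finite fun i =>
    ((isCompact_facet P i).isClosed.preimage continuous_subtype_val).isOpen_compl

theorem colorGroup_le_of_mem_openStar {m : ℕ} {c : Fin (k + n) → (Fin m → ZMod 2)}
    {I : Set (Fin (k + n))} {p q : P.carrier} (h : q ∈ openStar P p) :
    colorGroup P c I q ≤ colorGroup P c I p :=
  AddSubgroup.closure_mono (Set.image_mono fun i hi =>
    ⟨hi.1, by_contra fun hp => h i hp hi.2⟩)

/-- The translates of this neighborhood of `[p, w]` under elements outside of the stabilizer of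
`[p, w]` are disjoint from it. -/
theorem Glued.exists_nhds {m : ℕ} {c : Fin (k + n) → (Fin m → ZMod 2)}
    {I : Set (Fin (k + n))} (p : P.carrier) (w : Fin m → ZMod 2) :
    ∃ U ∈ nhds (Glued.mk p w : Glued P c I), ∀ g : Fin m → ZMod 2,
      ((g +ᵥ ·) '' U ∩ U).Nonempty → g ∈ colorGroup P c I p := by
  let U : Set (Glued P c I) := {x | ∃ q w', Glued.mk q w' = x ∧ q ∈ openStar P p ∧
    w' - w ∈ colorGroup P c I p}
  -- Membership in `U` does not depend on the representative: colors glued at a point of the open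
  -- star are already in the group at `p`.
  have hU : ∀ q w', (Glued.mk q w' : Glued P c I) ∈ U ↔
      q ∈ openStar P p ∧ w' - w ∈ colorGroup P c I p := by
    intro q w'
    refine ⟨?_, fun h => ⟨q, w', rfl, h⟩⟩
    rintro ⟨q', w'', h, hq, hw⟩
    obtain ⟨rfl, h2⟩ := Glued.mk_eq_mk.1 h
    refine ⟨hq, ?_⟩
    have := AddSubgroup.sub_mem _ hw (colorGroup_le_of_mem_openStar hq h2)
    rwa [sub_sub_sub_cancel_left] at this
  refine ⟨U, IsOpen.mem_nhds ?_ ?_, ?_⟩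
  · rw [← Glued.isQuotientMap_mk.isOpen_preimage]
    have : (fun a : P.carrier × (Fin m → ZMod 2) => (Glued.mk a.1 a.2 : Glued P c I)) ⁻¹' U =
        openStar P p ×ˢ {w' | w' - w ∈ colorGroup P c I p} := by
      ext a
      exact hU a.1 a.2
    rw [this]
    exact (isOpen_openStar p).prod (isOpen_discrete _)
  · rw [hU]
    exact ⟨fun i hi => hi, by simp⟩
  · rintro g ⟨_, ⟨x, hx, rfl⟩, hgx⟩
    induction x using Glued.ind with
    | h q w' =>
    -- Both `w'` and `g + w'` lie in the coset of `w`, so their difference `g` lies in the color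
    -- group.
    have h1 := ((hU _ _).1 hx).2
    have h2 := ((hU _ _).1 hgx).2
    have := AddSubgroup.sub_mem _ h2 h1
    rwa [sub_sub_sub_cancel_right, add_sub_cancel_right] at this

theorem CharFun.hom_continuous (μ : CharFun P) : Continuous μ.hom :=
  continuous_of_discreteTopology

/-- The projection `𝒵_P → Qⁿ` is the orbit map of the free action of `H_μ`. -/
theorem isAddQuotientCoveringMap_momentAngleProj (μ : CharFun P) :
    IsAddQuotientCoveringMap (momentAngleProj μ) μ.H where
  toIsQuotientMap := by
    have hc : Continuous (momentAngleProj μ) := continuous_quot_lift _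
      (Glued.continuous_mk.comp (continuous_fst.prodMk (μ.hom_continuous.comp continuous_snd)))
    -- Lifting through `embed` factors the quotient map onto `Qⁿ` through the projection, which is
    -- therefore a quotient map itself.
    let s : P.carrier × (Fin n → ZMod 2) → RealMomentAngle P :=
      fun a => Glued.mk a.1 (μ.embed a.2)
    have hs : Continuous s := Glued.continuous_mk.comp
      (continuous_fst.prodMk (continuous_of_discreteTopology.comp continuous_snd))
    refine Topology.IsQuotientMap.of_comp hs hc ?_
    have : momentAngleProj μ ∘ s = fun a => Glued.mk a.1 a.2 :=
      funext fun a => congrArg (Glued.mk a.1) (μ.hom_embed a.2)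
    rw [this]
    exact Glued.isQuotientMap_mk
  continuous_const_vadd g := Glued.continuous_vadd (g : Fin (k + n) → ZMod 2)
  apply_eq_iff_mem_orbit {x y} := by
    refine ⟨?_, ?_⟩
    · induction x using Glued.ind with
      | h p w =>
      induction y using Glued.ind with
      | h q v =>
      intro h
      obtain ⟨rfl, h2⟩ := Glued.mk_eq_mk.1 h
      rw [← μ.map_colorGroup_stdColor, ← map_sub] at h2
      obtain ⟨z, hz, hzw⟩ := h2
      have hzw' : μ.hom z = μ.hom (w - v) := hzw
      -- `z` fixes the points over `p` and has the same image under `hom` as `w - v`; subtracting it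
      -- moves `w - v` into `ker hom = H_μ`.
      refine ⟨⟨w - v - z, μ.mem_H_iff.2 (by rw [map_sub, hzw', sub_self])⟩, ?_⟩
      change (Glued.mk p (w - v - z + v) : RealMomentAngle P) = Glued.mk p w
      rw [Glued.mk_eq_mk]
      refine ⟨rfl, ?_⟩
      have : w - v - z + v - w = -z := by abel
      rw [this]
      exact AddSubgroup.neg_mem _ hz
    · rintro ⟨g, rfl⟩
      exact momentAngleProj_vadd μ g y
  disjoint x := by
    induction x using Glued.ind with
    | h p w =>
    obtain ⟨U, hU, hd⟩ := Glued.exists_nhds (c := stdColor n k) (I := Set.univ) p w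
    exact ⟨U, hU, fun g hg => Subtype.ext
      (μ.eq_zero_of_mem_colorGroup (hd g hg) (μ.hom_eq_zero g.2))⟩

/-! ### The equivalence of the glue-back space and the real moment-angle manifold -/

section Equivalence

variable (μ : CharFun P) {lam : Fin k → (Fin k → ZMod 2)} (hlam : MaximallyIndependent lam)

/-- Only facets through `v₀` occur on the left, and exactly for these `embed` is known to turn
`μ(Fⱼ)` into `eⱼ`. This is why the map to `𝒵_P` starts from the core and not from `Qⁿ`. -/
theorem CharFun.embed_mem_colorGroup {p : E} {w : Fin n → ZMod 2}
    (hw : w ∈ colorGroup P μ.toFun {i | k ≤ (i : ℕ)} p) :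
    μ.embed w ∈ colorGroup P (stdColor n k) Set.univ p := by
  have h : colorGroup P μ.toFun {i | k ≤ (i : ℕ)} p ≤
      (colorGroup P (stdColor n k) Set.univ p).comap μ.embed.toAddMonoidHom := by
    rw [colorGroup, AddSubgroup.closure_le]
    rintro _ ⟨i, ⟨hi, hp⟩, rfl⟩
    induction i using Fin.addCases with
    | left i => exact absurd hi (by simp)
    | right j =>
      change μ.embed (μ.toFun (Fin.natAdd k j)) ∈ colorGroup P (stdColor n k) Set.univ p
      rw [μ.embed_toFun_natAdd]
      exact color_mem_colorGroup trivial hp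
  exact h hw

/-- The map `Vⁿ → 𝒵_P`, `[p, w] ↦ [p, w]`. -/
def coreToMomentAngle : Core μ → RealMomentAngle P :=
  Quotient.map (sa := gluedSetoid P μ.toFun {i | k ≤ (i : ℕ)})
    (sb := gluedSetoid P (stdColor n k) Set.univ) (fun a => (a.1, μ.embed a.2)) (by
      rintro a b ⟨h1, h2⟩
      refine ⟨h1, ?_⟩
      dsimp only
      rw [← map_sub]
      exact μ.embed_mem_colorGroup h2)

theorem continuous_coreToMomentAngle : Continuous (coreToMomentAngle μ) :=
  continuous_quot_lift _ (Glued.continuous_mk.comp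
    (continuous_fst.prodMk (continuous_of_discreteTopology.comp continuous_snd)))

/-- The map `M(Vⁿ, λ) → 𝒵_P`, `[([p, w], g)] ↦ [p, w + σ(g)]`. -/
def glueBackToMomentAngle : GlueBackSpace (corePanels μ) lam → RealMomentAngle P :=
  GlueBackSpace.lift
    (fun a => (μ.colorEquiv hlam a.2 : Fin (k + n) → ZMod 2) +ᵥ coreToMomentAngle μ a.1) (by
    rintro ⟨x, g⟩ ⟨y, g'⟩ ⟨i, h, h1, h2⟩
    dsimp only at h h1 h2 ⊢
    rw [h1, h2, map_add, AddSubgroup.coe_add, μ.colorEquiv_apply hlam]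
    clear h1
    induction x using Glued.ind with
    | h p w =>
    change (Glued.mk p ((μ.colorEquiv hlam g : Fin (k + n) → ZMod 2) + μ.embed w) :
      RealMomentAngle P) = Glued.mk p ((μ.colorEquiv hlam g : Fin (k + n) → ZMod 2) + μ.gen i +
        μ.embed (μ.toFun (Fin.castAdd n i) + w))
    rw [Glued.mk_eq_mk]
    refine ⟨rfl, ?_⟩
    -- With `a = embed w`, `b = embed (μ(Fᵢ))`, `c = eᵢ` and `d = σ(g)`: the two copies of `b`
    -- cancel and `-eᵢ` remains, which is in the color group as `p` lies in `Fᵢ`.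
    have h0 : ∀ a b c d : Fin (k + n) → ZMod 2, d + a - (d + (c + b) + (b + a)) = -(b + b) - c := by
      intro a b c d
      abel
    rw [map_add, CharFun.gen, h0, add_self_zmod_two, neg_zero, zero_sub]
    exact AddSubgroup.neg_mem _ (color_mem_colorGroup trivial h))

theorem continuous_glueBackToMomentAngle : Continuous (glueBackToMomentAngle μ hlam) := by
  refine continuous_quot_lift _ (continuous_prod_of_discrete_right.2 fun g => ?_)
  exact (Glued.continuous_vadd (μ.colorEquiv hlam g : Fin (k + n) → ZMod 2)).comp
    (continuous_coreToMomentAngle μ)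

theorem GlueBackSpace.continuous_mk {X : Type*} [TopologicalSpace X] {m : ℕ}
    {S : PanelStructure X k} {c : Fin k → (Fin m → ZMod 2)} :
    Continuous (fun a : X × (Fin m → ZMod 2) => (GlueBackSpace.mk a.1 a.2 : GlueBackSpace S c)) :=
  continuous_quotient_mk'

theorem GlueBackSpace.ind {X : Type*} [TopologicalSpace X] {m : ℕ}
    {S : PanelStructure X k} {c : Fin k → (Fin m → ZMod 2)} {C : GlueBackSpace S c → Prop}
    (h : ∀ x g, C (GlueBackSpace.mk x g)) (y : GlueBackSpace S c) : C y :=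
  Quotient.inductionOn y fun a => h a.1 a.2

/-! ### The inverse map -/

/-- `(ℤ₂)ᵏ⁺ⁿ → (ℤ₂)ᵏ` with `eᵢ ↦ λ(Pᵢ)` for `i ≤ k` and `eᵢ ↦ 0` for `i > k`. -/
def MaximallyIndependent.colorHom : (Fin (k + n) → ZMod 2) →+ (Fin k → ZMod 2) :=
  hlam.basis.equivFun.symm.toAddEquiv.toAddMonoidHom.comp (restrictFirst n k).toAddMonoidHom

theorem MaximallyIndependent.colorHom_castAdd (i : Fin k) :
    hlam.colorHom (stdColor n k (Fin.castAdd n i)) = lam i := by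
  change hlam.basis.equivFun.symm (restrictFirst n k (stdColor n k (Fin.castAdd n i))) = lam i
  rw [restrictFirst_stdColor_castAdd]
  simp [MaximallyIndependent.basis]

theorem MaximallyIndependent.colorHom_natAdd (j : Fin n) :
    hlam.colorHom (stdColor n k (Fin.natAdd k j)) = 0 := by
  change hlam.basis.equivFun.symm (restrictFirst n k (stdColor n k (Fin.natAdd k j))) = 0
  rw [restrictFirst_stdColor_natAdd, map_zero]

theorem CharFun.colorEquiv_colorHom (x : Fin (k + n) → ZMod 2) :
    (μ.colorEquiv hlam (hlam.colorHom x) : Fin (k + n) → ZMod 2) =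
      μ.genHom (restrictFirst n k x) := by
  change μ.genHom (hlam.basis.equivFun (hlam.basis.equivFun.symm _)) = _
  rw [LinearEquiv.apply_symm_apply]
  rfl

theorem CharFun.colorHom_embed (w : Fin n → ZMod 2) : hlam.colorHom (μ.embed w) = 0 := by
  change hlam.basis.equivFun.symm (restrictFirst n k (μ.embed w)) = 0
  rw [μ.restrictFirst_embed, map_zero]

theorem CharFun.colorHom_colorEquiv (g : Fin k → ZMod 2) :
    hlam.colorHom (μ.colorEquiv hlam g : Fin (k + n) → ZMod 2) = g := by
  change hlam.basis.equivFun.symm (restrictFirst n k (μ.genHom (hlam.basis.equivFun g))) = g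
  rw [μ.restrictFirst_genHom, LinearEquiv.symm_apply_apply]

/-- Changing the representative of a point of `𝒵_P` does not change the point
`[([p, hom x], colorHom x)]`. -/
theorem glueBack_mk_eq_of_mem {p : P.carrier} {z : Fin (k + n) → ZMod 2}
    (hz : z ∈ colorGroup P (stdColor n k) Set.univ (p : E)) (x : Fin (k + n) → ZMod 2) :
    (GlueBackSpace.mk (Glued.mk p (μ.hom (z + x))) (hlam.colorHom (z + x)) :
        GlueBackSpace (corePanels μ) lam) =
      GlueBackSpace.mk (Glued.mk p (μ.hom x)) (hlam.colorHom x) := by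
  -- `x` must vary: sums use the hypothesis at `z + x`, negatives at `-z + x`.
  induction hz using AddSubgroup.closure_induction generalizing x with
  | mem z hz =>
    obtain ⟨i, ⟨-, hp⟩, rfl⟩ := hz
    rw [map_add, map_add, μ.hom_stdColor]
    -- Adding `eᵢ` with `i ≤ k` is one gluing by `τᵢ`; for a facet through `v₀` the color is
    -- unchanged and the two points already agree in the core.
    induction i using Fin.addCases with
    | left i =>
      rw [hlam.colorHom_castAdd]
      refine (Quotient.sound (Relation.EqvGen.rel _ _ ⟨i, hp, rfl, ?_⟩)).symm
      exact add_comm _ _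
    | right j =>
      rw [hlam.colorHom_natAdd, zero_add]
      congr 1
      rw [Glued.mk_eq_mk, add_sub_cancel_right]
      exact ⟨rfl, color_mem_colorGroup (by simp) hp⟩
  | zero => rw [zero_add]
  | add y z _ _ hy hz => rw [add_assoc, hy, hz]
  | neg z _ hz => rw [← hz (-z + x), add_neg_cancel_left]

/-- The map `𝒵_P → M(Vⁿ, λ)` inverse to `glueBackToMomentAngle`. -/
def momentAngleToGlueBack : RealMomentAngle P → GlueBackSpace (corePanels μ) lam :=
  Quotient.lift (s := gluedSetoid P (stdColor n k) Set.univ)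
    (fun a => GlueBackSpace.mk (Glued.mk a.1 (μ.hom a.2)) (hlam.colorHom a.2)) (by
      rintro ⟨p, x⟩ ⟨q, y⟩ ⟨h1, h2⟩
      dsimp only at h1 h2 ⊢
      subst h1
      have h := glueBack_mk_eq_of_mem μ hlam h2 y
      rwa [sub_add_cancel] at h)

theorem continuous_momentAngleToGlueBack : Continuous (momentAngleToGlueBack μ hlam) :=
  continuous_quot_lift _ (GlueBackSpace.continuous_mk.comp
    ((Glued.continuous_mk.comp
      (continuous_fst.prodMk (μ.hom_continuous.comp continuous_snd))).prodMk
        (continuous_of_discreteTopology.comp continuous_snd)))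

/-- The homeomorphism `M(Vⁿ, λ) ≃ 𝒵_P`. -/
def glueBackHomeomorph : GlueBackSpace (corePanels μ) lam ≃ₜ RealMomentAngle P where
  toFun := glueBackToMomentAngle μ hlam
  invFun := momentAngleToGlueBack μ hlam
  left_inv x := by
    induction x using GlueBackSpace.ind with
    | h x g =>
    induction x using Glued.ind with
    | h p w =>
    change GlueBackSpace.mk
      (Glued.mk p (μ.hom ((μ.colorEquiv hlam g : Fin (k + n) → ZMod 2) + μ.embed w)))
      (hlam.colorHom ((μ.colorEquiv hlam g : Fin (k + n) → ZMod 2) + μ.embed w)) = _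
    -- On `σ(g) + embed w`, `hom` sees only `w` and `colorHom` only `g`.
    rw [map_add, map_add, μ.hom_eq_zero (μ.colorEquiv hlam g).2, μ.hom_embed, zero_add,
      μ.colorHom_colorEquiv, μ.colorHom_embed, add_zero]
  right_inv x := by
    induction x using Glued.ind with
    | h p x =>
    change Glued.mk p ((μ.colorEquiv hlam (hlam.colorHom x) : Fin (k + n) → ZMod 2) +
      μ.embed (μ.hom x)) = _
    rw [μ.colorEquiv_colorHom]
    exact congrArg (Glued.mk p) ((add_comm _ _).trans (μ.embed_hom_add_genHom x))
  continuous_toFun := continuous_glueBackToMomentAngle μ hlam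
  continuous_invFun := continuous_momentAngleToGlueBack μ hlam

/-- The covering property is checked directly only for `𝒵_P`; the glue-back space inherits it
through the homeomorphism. -/
theorem equivalentActions_glueBack_momentAngle :
    EquivalentActions (glueBackProj μ lam) (momentAngleProj μ) (μ.colorEquiv hlam) := by
  have hf : ∀ (g : Fin k → ZMod 2) (x : GlueBackSpace (corePanels μ) lam),
      glueBackHomeomorph μ hlam (g +ᵥ x) =
        μ.colorEquiv hlam g +ᵥ glueBackHomeomorph μ hlam x := by
    intro g x
    induction x using GlueBackSpace.ind with
    | h x g' =>
    change (μ.colorEquiv hlam (g + g') : Fin (k + n) → ZMod 2) +ᵥ coreToMomentAngle μ x =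
      (μ.colorEquiv hlam g : Fin (k + n) → ZMod 2) +ᵥ
        ((μ.colorEquiv hlam g' : Fin (k + n) → ZMod 2) +ᵥ coreToMomentAngle μ x)
    rw [map_add, AddSubgroup.coe_add, add_vadd]
  have hπ : ∀ x : GlueBackSpace (corePanels μ) lam,
      momentAngleProj μ (glueBackHomeomorph μ hlam x) = glueBackProj μ lam x := by
    intro x
    induction x using GlueBackSpace.ind with
    | h x g =>
    -- The element `σ(g)` of `H_μ` acts trivially on `Qⁿ`, which reduces the claim to `g = 0`.
    refine (momentAngleProj_vadd μ (μ.colorEquiv hlam g) (coreToMomentAngle μ x)).trans ?_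
    induction x using Glued.ind with
    | h p w => exact congrArg (Glued.mk p) (μ.hom_embed w)
  have h := isAddQuotientCoveringMap_momentAngleProj μ
  exact ⟨isAddQuotientCoveringMap_of_homeomorph _ _ hf hπ h, h, glueBackHomeomorph μ hlam, hf, hπ⟩

end Equivalence

end GlueBack

end

theorem mainTheorem3 {n k : ℕ} {E : Type*} [NormedAddCommGroup E] [NormedSpace ℝ E]
    (P : SimplePolytope n k E) (μ : CharFun P)
    (lam : Fin k → (Fin k → ZMod 2)) (hlam : MaximallyIndependent lam) :
    ∃ σ : (Fin k → ZMod 2) ≃+ μ.H,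
      (∀ i, (σ (lam i) : Fin (k + n) → ZMod 2) = μ.gen i) ∧
      EquivalentActions (glueBackProj μ lam) (momentAngleProj μ) σ ∧
      ∀ N : AddSubgroup (Fin k → ZMod 2),
        EquivalentActions
          (OrbitSpace.desc N (glueBackProj μ lam) (glueBackProj_vadd μ lam))
          (OrbitSpace.desc (N.map (σ : (Fin k → ZMod 2) →+ μ.H)) (momentAngleProj μ)
            (momentAngleProj_vadd μ))
          (QuotientAddGroup.congr N (N.map (σ : (Fin k → ZMod 2) →+ μ.H)) σ rfl) := by
  refine ⟨μ.colorEquiv hlam, μ.colorEquiv_apply hlam,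
    equivalentActions_glueBack_momentAngle μ hlam, fun N => ?_⟩
  exact (equivalentActions_glueBack_momentAngle μ hlam).orbitSpace _ _ N
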